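/- Let $(\varepsilon_k)_{k\ge1}$ be any sequence of positive real numbers with $\varepsilon_k\to0$. Then there exist a sequence $(n_k)_{k\ge1}$ of positive integers, an index $k_0$ with $$\frac{n_{k+1}}{n_k}\ge 1+\varepsilon_k\qquad\text{for all }k\ge k_0,$$ and a permutation $\sigma$ of the positive integers such that both of the following statements are false: (a) (permuted central limit theorem) for every real $t$, $$\lim_{N\to\infty}\lambda\Big\{x\in(0,1):\ \sum_{k=1}^N\cos 2\pi n_{\sigma(k)}x\le t\sqrt{N/2}\Big\}=(2\pi)^{-1/2}\int_{-\infty}^t e^{-u^2/2}\,du,$$ where $\lambda$ denotes Lebesgue measure; (b) (permuted law of the iterated logarithm) $$\limsup_{N\to\infty}\,(N\log\log N)^{-1/2}\sum_{k=1}^N\cos 2\pi n_{\sigma(k)}x=1\qquad\text{for almost every }x\in(0,1).$$ -/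

import Mathlib

open Filter Topology MeasureTheory

/-- The rearranged partial sum: the first `N` terms of `∑ cos (2 π n_{σ(k)} x)`.
Sequences are indexed by `ℕ`, the index `k` standing for the `(k + 1)`-st term. -/
noncomputable def permutedSum (n : ℕ → ℕ) (σ : Equiv.Perm ℕ) (N : ℕ) (x : ℝ) : ℝ :=
  ∑ k ∈ Finset.range N, Real.cos (2 * Real.pi * (n (σ k) : ℝ) * x)

/-- The permuted central limit theorem: for every real `t`, the Lebesgue measure of the set of
`x ∈ (0, 1)` with `∑_{k ≤ N} cos (2 π n_{σ(k)} x) ≤ t √(N / 2)` tends to the standard normal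
distribution function at `t` as `N → ∞`. -/
def PermutedCLT (n : ℕ → ℕ) (σ : Equiv.Perm ℕ) : Prop :=
  ∀ t : ℝ, Tendsto
    (fun N : ℕ =>
      volume.real {x : ℝ | x ∈ Set.Ioo (0 : ℝ) 1 ∧ permutedSum n σ N x ≤ t * √((N : ℝ) / 2)})
    atTop
    (𝓝 ((2 * Real.pi) ^ (-(1 / 2) : ℝ) * ∫ u in Set.Iic t, Real.exp (-u ^ 2 / 2)))

/-- The permuted law of the iterated logarithm: for almost every `x ∈ (0, 1)`, the upper limit,
taken in the extended reals, of `(N log log N)^{-1/2} ∑_{k ≤ N} cos (2 π n_{σ(k)} x)` is `1`. -/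
def PermutedLIL (n : ℕ → ℕ) (σ : Equiv.Perm ℕ) : Prop :=
  ∀ᵐ x ∂(volume.restrict (Set.Ioo (0 : ℝ) 1)),
    limsup (fun N : ℕ =>
      ((permutedSum n σ N x / √((N : ℝ) * Real.log (Real.log (N : ℝ))) : ℝ) : EReal)) atTop = 1

/-! The multiples `c, 2c, 3c, ...` of one integer have ratios `1 + 1/m`, so a run of length `2 ^ j`
is allowed once `ε` has dropped to `2 ^ -(j+1)`. Delaying the `j`-th run that far, with a geometric
filler between runs, gives the gap condition. The permutation moves all unwanted terms to the sparse
positions `2 ^ i`, so each remaining dyadic block of the rearranged sum is a Dirichlet kernel at `c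
j * x`, bounded by `1 / |sin (π c_j x)|`. By Borel-Cantelli (`ae_eventually_le_norm_mul`) this is
`O((4/3) ^ j)` for almost every `x`. As `4/3 < √2`, the sum is almost everywhere `o(√N)`
(`tendsto_permutedSum_div_sqrt`), too small for either limit theorem. -/

/-! ### Extending an injection off an infinite set to a permutation -/

/-- An injection defined off an infinite set whose image has infinite complement extends to a
permutation of `ℕ`. -/
theorem exists_perm_eq_off {g : ℕ → ℕ} {S : Set ℕ} (hg : Set.InjOn g Sᶜ) (hS : S.Infinite)
    (hgS : (g '' Sᶜ)ᶜ.Infinite) : ∃ σ : Equiv.Perm ℕ, ∀ k ∉ S, σ k = g k := by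
  classical
  have := hS.to_subtype
  have := hgS.to_subtype
  obtain ⟨e₁⟩ : Nonempty (S ≃ ((g '' Sᶜ)ᶜ : Set ℕ)) := nonempty_equiv_of_countable
  let e₂ : (Sᶜ : Set ℕ) ≃ (g '' Sᶜ : Set ℕ) := Equiv.Set.imageOfInjOn g Sᶜ hg
  let e₃ : (S ⊕ (Sᶜ : Set ℕ)) ≃ ((g '' Sᶜ : Set ℕ) ⊕ ((g '' Sᶜ)ᶜ : Set ℕ)) :=
    (Equiv.sumComm _ _).trans (Equiv.sumCongr e₂ e₁)
  refine ⟨(Equiv.Set.sumCompl S).symm.trans (e₃.trans (Equiv.Set.sumCompl (g '' Sᶜ))), ?_⟩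
  intro k hk
  simp [Equiv.Set.sumCompl_symm_apply_of_notMem hk, e₃, e₂, Equiv.Set.imageOfInjOn]

/-! ### A sparse sequence containing long dilated runs of consecutive integers -/

/-- Positions of the dilated runs: the `j`-th dyadic run of indices is delayed by `E j`. -/
def delayedIndex (E : ℕ → ℕ) (k : ℕ) : ℕ := k + E (Nat.log 2 (k + 1))

/-- The dilation factor of the `j`-th run. -/
def runFactor (E : ℕ → ℕ) (j : ℕ) : ℕ := 4 ^ (2 ^ j + E j)

open Classical in
/-- The sequence which on the `j`-th run takes the values `runFactor E j * m` with
`2 ^ j ≤ m < 2 ^ (j + 1)`, and grows geometrically outside the runs. -/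
noncomputable def runSequence (E : ℕ → ℕ) : ℕ → ℕ :=
  Function.extend (delayedIndex E) (fun k => runFactor E (Nat.log 2 (k + 1)) * (k + 1))
    fun p => 4 ^ (p + 1)

theorem delayedIndex_strictMono {E : ℕ → ℕ} (hE : Monotone E) : StrictMono (delayedIndex E) := by
  intro a b h
  have := hE (Nat.log_mono_right (b := 2) (Nat.succ_le_succ h.le))
  simp only [delayedIndex, Nat.succ_eq_add_one] at *
  omega

theorem runSequence_delayedIndex {E : ℕ → ℕ} (hE : Monotone E) (k : ℕ) :
    runSequence E (delayedIndex E k) = runFactor E (Nat.log 2 (k + 1)) * (k + 1) :=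
  (delayedIndex_strictMono hE).injective.extend_apply _ _ _

theorem runSequence_of_notMem {E : ℕ → ℕ} {p : ℕ} (h : ¬∃ k, delayedIndex E k = p) :
    runSequence E p = 4 ^ (p + 1) :=
  Function.extend_apply' _ _ _ h

theorem runFactor_pos (E : ℕ → ℕ) (j : ℕ) : 0 < runFactor E j := by
  unfold runFactor; positivity

theorem runSequence_pos {E : ℕ → ℕ} (hE : Monotone E) (p : ℕ) : 0 < runSequence E p := by
  by_cases h : ∃ k, delayedIndex E k = p
  · obtain ⟨k, rfl⟩ := h
    rw [runSequence_delayedIndex hE]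
    exact Nat.mul_pos (runFactor_pos E _) k.succ_pos
  · rw [runSequence_of_notMem h]; positivity

theorem two_mul_add_one_le_four_pow (m : ℕ) : 2 * m + 1 ≤ 4 ^ m := by
  induction m with
  | zero => simp
  | succ m ih => rw [pow_succ]; omega

/-- Consecutive terms of `runSequence` are either consecutive members of one run, or they have
ratio at least `2`. -/
theorem runSequence_step {E : ℕ → ℕ} (hE : Monotone E) (p : ℕ) :
    (∃ k, E (Nat.log 2 (k + 1)) ≤ p ∧
      ∃ c > 0, runSequence E p = c * (k + 1) ∧ runSequence E (p + 1) = c * (k + 2)) ∨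
    2 * runSequence E p ≤ runSequence E (p + 1) := by
  by_cases hrun : ∃ k, delayedIndex E k = p ∧ Nat.log 2 (k + 2) = Nat.log 2 (k + 1)
  · obtain ⟨k, rfl, hk⟩ := hrun
    refine Or.inl ⟨k, by simp [delayedIndex], _, runFactor_pos E _,
      runSequence_delayedIndex hE k, ?_⟩
    have h1 : delayedIndex E k + 1 = delayedIndex E (k + 1) := by
      simp only [delayedIndex, hk]; ring
    rw [h1, runSequence_delayedIndex hE, hk]
  · right
    -- Here `p` is a filler position or the end of a run, and `p + 1` a filler position or the start
    -- of a run; `4 ^ (p + 1)` separates them. A run ends at `c (2 ^ (j + 1) - 1)`, and the `2 ^ j -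
    -- 1` steps since its start leave room for that factor.
    have upper : runSequence E p ≤ 4 ^ (p + 1) := by
      by_cases h : ∃ k, delayedIndex E k = p
      · obtain ⟨k, rfl⟩ := h
        have hne : Nat.log 2 (k + 2) ≠ Nat.log 2 (k + 1) := fun h' => hrun ⟨k, rfl, h'⟩
        rw [runSequence_delayedIndex hE]
        have h1 : 2 ^ Nat.log 2 (k + 1) ≤ k + 1 := Nat.pow_log_le_self 2 k.succ_ne_zero
        have h2 : k + 1 < 2 ^ (Nat.log 2 (k + 1) + 1) := Nat.lt_pow_succ_log_self one_lt_two _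
        have h3 : k + 2 = 2 ^ (Nat.log 2 (k + 1) + 1) := by
          by_contra h3
          apply hne
          rw [Nat.log_eq_iff (by right; omega)]
          omega
        generalize Nat.log 2 (k + 1) = j at *
        have hp : 0 < 2 ^ j := by positivity
        obtain ⟨m, hm⟩ : ∃ m, 2 ^ j = m + 1 := ⟨2 ^ j - 1, by omega⟩
        have hk : k = 2 * m := by rw [pow_succ] at h3; omega
        have hlog : Nat.log 2 (k + 1) = j := by
          rw [Nat.log_eq_iff (by right; omega)]; omega
        have : delayedIndex E k + 1 = (2 ^ j + E j) + m := by
          rw [delayedIndex, hlog]; omega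
        rw [this, runFactor, pow_add 4 _ m]
        exact Nat.mul_le_mul_left _ (hk ▸ two_mul_add_one_le_four_pow m)
      · rw [runSequence_of_notMem h]
    have lower : 4 ^ (p + 2) ≤ runSequence E (p + 1) := by
      by_cases h : ∃ k, delayedIndex E k = p + 1
      · obtain ⟨k, hk⟩ := h
        rw [← hk, runSequence_delayedIndex hE]
        have h1 : 2 ^ Nat.log 2 (k + 1) ≤ k + 1 := Nat.pow_log_le_self 2 k.succ_ne_zero
        have h2 : k + 1 < 2 ^ (Nat.log 2 (k + 1) + 1) := Nat.lt_pow_succ_log_self one_lt_two _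
        have h3 : k + 1 = 2 ^ Nat.log 2 (k + 1) := by
          by_contra h3
          have hk0 : k ≠ 0 := by rintro rfl; simp at h3
          obtain ⟨l, rfl⟩ := Nat.exists_eq_succ_of_ne_zero hk0
          have hl : Nat.log 2 (l + 1) = Nat.log 2 (l + 2) := by
            rw [Nat.log_eq_iff (by right; omega)]
            simp only [Nat.succ_eq_add_one, show l + 1 + 1 = l + 2 from rfl] at *
            omega
          refine hrun ⟨l, ?_, hl.symm⟩
          simp only [delayedIndex, Nat.succ_eq_add_one, show l + 1 + 1 = l + 2 from rfl] at *
          rw [hl]; omega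
        have h4 : p + 2 = 2 ^ Nat.log 2 (k + 1) + E (Nat.log 2 (k + 1)) := by
          rw [delayedIndex] at hk; omega
        rw [runFactor, ← h4]
        exact Nat.le_mul_of_pos_right _ k.succ_pos
      · rw [runSequence_of_notMem h]
    have : 4 ^ (p + 2) = 4 * 4 ^ (p + 1) := by ring
    omega

/-- For `ε → 0` there is a sequence with gaps `1 + ε k` and a permutation of it that consists of
dilated runs of consecutive integers, except at powers of two. -/
theorem exists_sequence_perm_runs {ε : ℕ → ℝ} (hlim : Tendsto ε atTop (𝓝 0)) :
    ∃ (n : ℕ → ℕ) (σ : Equiv.Perm ℕ) (c : ℕ → ℕ), (∀ k, 0 < n k) ∧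
      (∃ k₀ : ℕ, ∀ k ≥ k₀, (n (k + 1) : ℝ) / (n k : ℝ) ≥ 1 + ε k) ∧ (∀ j, 0 < c j) ∧
      ∀ j k, 2 ^ j < k + 1 → k + 1 < 2 ^ (j + 1) → n (σ k) = c j * (k + 1) := by
  have hε : ∀ j : ℕ, ∃ e : ℕ, ∀ k ≥ e, ε k ≤ (1 / 2 : ℝ) ^ (j + 1) := fun j =>
    eventually_atTop.1 (hlim.eventually_le_const (by positivity))
  choose e he using hε
  -- Partial sums turn the thresholds `e` into a monotone delay that still dominates them.
  let E : ℕ → ℕ := fun j => ∑ i ∈ Finset.range (j + 1), e i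
  have hE : Monotone E := fun a b h =>
    Finset.sum_le_sum_of_subset (Finset.range_mono (Nat.succ_le_succ h))
  have heE : ∀ j, e j ≤ E j := fun j =>
    Finset.single_le_sum (f := e) (fun _ _ => Nat.zero_le _) (Finset.self_mem_range_succ j)
  have hinj := (delayedIndex_strictMono hE).injective
  have hpow : Function.Injective fun j : ℕ => 2 ^ j - 1 := by
    intro a b h
    have ha : 0 < 2 ^ a := by positivity
    have hb : 0 < 2 ^ b := by positivity
    exact Nat.pow_right_injective le_rfl (by simp only at *; omega)
  let S : Set ℕ := Set.range fun j : ℕ => 2 ^ j - 1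
  have hS : S.Infinite := Set.infinite_range_of_injective hpow
  -- The first term of every run is left out of the prescribed image, which keeps the complement
  -- infinite even if `E` is bounded and there is little filler.
  have hgS : (delayedIndex E '' Sᶜ)ᶜ.Infinite := by
    refine (hS.image hinj.injOn).mono ?_
    rintro _ ⟨k, hk, rfl⟩ ⟨l, hl, h⟩
    exact hl (hinj h ▸ hk)
  obtain ⟨σ, hσ⟩ := exists_perm_eq_off hinj.injOn hS hgS
  refine ⟨runSequence E, σ, runFactor E, runSequence_pos hE, ⟨e 0, fun k hk => ?_⟩,
    runFactor_pos E, fun j k h1 h2 => ?_⟩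
  · have hpos : (0 : ℝ) < runSequence E k := by exact_mod_cast runSequence_pos hE k
    rw [ge_iff_le, le_div_iff₀ hpos]
    obtain ⟨l, hl, c, hc, h1, h2⟩ | h := runSequence_step hE k
    · have hεk := he _ k ((heE _).trans hl)
      have hl2 : ((l : ℝ) + 1) ≤ 2 ^ (Nat.log 2 (l + 1) + 1) := by
        exact_mod_cast (Nat.lt_pow_succ_log_self one_lt_two (l + 1)).le
      have hεl : ε k * ((l : ℝ) + 1) ≤ 1 := by
        calc ε k * ((l : ℝ) + 1)
            ≤ (1 / 2 : ℝ) ^ (Nat.log 2 (l + 1) + 1) * ((l : ℝ) + 1) := by gcongr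
          _ ≤ (1 / 2 : ℝ) ^ (Nat.log 2 (l + 1) + 1) * 2 ^ (Nat.log 2 (l + 1) + 1) := by gcongr
          _ = 1 := by rw [← mul_pow]; norm_num
      rw [h1, h2]
      push_cast
      have hc' : (0 : ℝ) < c := by exact_mod_cast hc
      nlinarith
    · have hεk := he 0 k hk
      have h' : (2 : ℝ) * runSequence E k ≤ runSequence E (k + 1) := by exact_mod_cast h
      norm_num at hεk
      nlinarith
  · have hk : k ∉ S := by
      rintro ⟨i, hi⟩
      have hi' : k + 1 = 2 ^ i := by
        have : 0 < 2 ^ i := by positivity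
        simp only at hi
        omega
      rw [hi'] at h1 h2
      have := (Nat.pow_lt_pow_iff_right one_lt_two).1 h1
      have := (Nat.pow_lt_pow_iff_right one_lt_two).1 h2
      omega
    have hlog : Nat.log 2 (k + 1) = j := by
      rw [Nat.log_eq_iff (by right; omega)]; omega
    rw [hσ k hk, runSequence_delayedIndex hE, hlog]

/-! ### Sums of cosines over an arithmetic progression -/

/-- Multiplying by `2 sin (π y)` makes the sum telescope. -/
theorem abs_sum_cos_Ico_le (y : ℝ) (hy : Real.sin (Real.pi * y) ≠ 0) (u v : ℕ) :
    |∑ m ∈ Finset.Ico u v, Real.cos (2 * Real.pi * m * y)| ≤ 1 / |Real.sin (Real.pi * y)| := by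
  rcases le_total v u with h | h
  · simp [Finset.Ico_eq_empty_of_le h]
  have key : 2 * Real.sin (Real.pi * y) * ∑ m ∈ Finset.Ico u v, Real.cos (2 * Real.pi * m * y) =
      Real.sin (Real.pi * (2 * v - 1) * y) - Real.sin (Real.pi * (2 * u - 1) * y) := by
    rw [← Finset.sum_Ico_sub (fun m : ℕ => Real.sin (Real.pi * (2 * m - 1) * y)) h,
      Finset.mul_sum]
    refine Finset.sum_congr rfl fun m _ => ?_
    have h1 : Real.pi * (2 * ((m + 1 : ℕ) : ℝ) - 1) * y = 2 * Real.pi * m * y + Real.pi * y := by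
      push_cast; ring
    have h2 : Real.pi * (2 * (m : ℝ) - 1) * y = 2 * Real.pi * m * y - Real.pi * y := by ring
    rw [h1, h2, Real.sin_add, Real.sin_sub]
    ring
  rw [le_div_iff₀ (abs_pos.2 hy), ← abs_mul]
  have h1 := Real.abs_sin_le_one (Real.pi * (2 * v - 1) * y)
  have h2 := Real.abs_sin_le_one (Real.pi * (2 * u - 1) * y)
  rw [abs_le] at *
  constructor <;> linarith [h1.1, h1.2, h2.1, h2.2]

theorem two_mul_norm_le_abs_sin (y : ℝ) :
    2 * ‖(y : UnitAddCircle)‖ ≤ |Real.sin (Real.pi * y)| := by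
  have h1 : |Real.sin (Real.pi * y)| = |Real.sin (Real.pi * (y - round y))| := by
    rw [mul_sub, mul_comm Real.pi (round y : ℝ), Real.sin_sub_int_mul_pi, abs_mul, abs_zpow]
    simp
  rw [UnitAddCircle.norm_eq, h1]
  have h2 : |Real.pi * (y - round y)| ≤ Real.pi / 2 := by
    rw [abs_mul, abs_of_pos Real.pi_pos]
    nlinarith [abs_sub_round y, Real.pi_pos]
  have h3 := Real.mul_abs_le_abs_sin h2
  rw [abs_mul, abs_of_pos Real.pi_pos] at h3
  calc 2 * |y - round y| = 2 / Real.pi * (Real.pi * |y - round y|) := by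
        field_simp
    _ ≤ _ := h3

/-- For almost every `x`, the multiples `c j * x` are eventually at distance at least `(3/4) ^ j`
from the integers. -/
theorem ae_eventually_le_norm_mul {c : ℕ → ℕ} (hc : ∀ j, 0 < c j) :
    ∀ᵐ x ∂(volume.restrict (Set.Ioo (0 : ℝ) 1)),
      ∀ᶠ j in atTop, (3 / 4 : ℝ) ^ j ≤ ‖((c j * x : ℝ) : UnitAddCircle)‖ := by
  -- Multiplication by a nonzero integer preserves Haar measure on the circle, so the exceptional
  -- sets have measure at most `2 (3/4) ^ j` whatever `c j` is.
  have hmp : ∀ j, MeasurePreserving (fun x : ℝ => ((c j * x : ℝ) : UnitAddCircle))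
      (volume.restrict (Set.Ioc (0 : ℝ) (0 + 1))) volume := by
    intro j
    have h1 := UnitAddCircle.measurePreserving_mk 0
    have h2 : MeasurePreserving (fun z : UnitAddCircle => c j • z) volume volume := by
      simpa using Measure.measurePreserving_zsmul (volume : Measure UnitAddCircle)
        (Nat.cast_ne_zero.2 (hc j).ne' : (c j : ℤ) ≠ 0)
    have h3 := h2.comp h1
    convert h3 using 1
    ext x
    simp [← nsmul_eq_mul]
  rw [zero_add] at hmp
  rw [Measure.restrict_congr_set Ioo_ae_eq_Ioc]
  have hbc := ae_eventually_notMem (μ := volume.restrict (Set.Ioc (0 : ℝ) 1))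
    (s := fun j => (fun x : ℝ => ((c j * x : ℝ) : UnitAddCircle)) ⁻¹'
      Metric.ball 0 ((3 / 4 : ℝ) ^ j)) ?_
  · filter_upwards [hbc] with x hx
    filter_upwards [hx] with j hj
    simpa using hj
  · refine ne_top_of_le_ne_top (b := ∑' j : ℕ, ENNReal.ofReal (2 * (3 / 4 : ℝ) ^ j)) ?_ ?_
    · have hs : Summable fun j : ℕ => 2 * (3 / 4 : ℝ) ^ j :=
        (summable_geometric_of_lt_one (by norm_num) (by norm_num)).mul_left 2
      exact hs.tsum_ofReal_ne_top
    · refine ENNReal.tsum_le_tsum fun j => ?_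
      rw [(hmp j).measure_preimage Metric.isOpen_ball.measurableSet.nullMeasurableSet]
      refine (measure_mono Metric.ball_subset_closedBall).trans ?_
      rw [AddCircle.volume_closedBall]
      exact ENNReal.ofReal_le_ofReal (min_le_right _ _)

/-! ### Rearranged sums consisting of dyadic runs -/

theorem abs_sum_Ico_le_of_dyadic {f : ℕ → ℝ} {C : ℝ} (hC : 0 ≤ C)
    (hf : ∀ j v : ℕ, v ≤ 2 ^ (j + 1) → |∑ m ∈ Finset.Ico (2 ^ j) v, f m| ≤ C * (4 / 3 : ℝ) ^ j)
    (J N : ℕ) (hN : N ≤ 2 ^ (J + 1)) :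
    |∑ m ∈ Finset.Ico 1 N, f m| ≤ 4 * C * (4 / 3 : ℝ) ^ J := by
  induction J generalizing N with
  | zero =>
    have := hf 0 N hN
    simp only [pow_zero] at this ⊢
    linarith
  | succ J ih =>
    rcases le_total N (2 ^ (J + 1)) with h | h
    · refine (ih N h).trans ?_
      gcongr
      · norm_num
      · omega
    · rw [← Finset.sum_Ico_consecutive f Nat.one_le_two_pow h]
      have h1 := ih _ le_rfl
      have h2 := hf (J + 1) N hN
      refine (abs_add_le _ _).trans ((add_le_add h1 h2).trans (le_of_eq ?_))
      ring

theorem tendsto_permutedSum_div_sqrt {n : ℕ → ℕ} {σ : Equiv.Perm ℕ} {c : ℕ → ℕ}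
    (hn : ∀ j k, 2 ^ j < k + 1 → k + 1 < 2 ^ (j + 1) → n (σ k) = c j * (k + 1)) {x : ℝ}
    (hx : ∀ᶠ j in atTop, (3 / 4 : ℝ) ^ j ≤ ‖((c j * x : ℝ) : UnitAddCircle)‖) :
    Tendsto (fun N : ℕ => permutedSum n σ N x / √N) atTop (𝓝 0) := by
  obtain ⟨j₀, hj₀⟩ := eventually_atTop.1 hx
  let f : ℕ → ℝ := fun m => Real.cos (2 * Real.pi * (n (σ (m - 1)) : ℝ) * x)
  have hsum : ∀ N, permutedSum n σ N x = ∑ m ∈ Finset.Ico 1 (N + 1), f m := by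
    intro N
    rw [permutedSum, Finset.range_eq_Ico, ← Finset.sum_Ico_add' f 0 N 1]
    simp [f]
  -- `2 ^ j₀` bounds the length of each run before `j₀`; from `j₀` on, the term at the power of two
  -- costs 1 and the kernel `(4/3) ^ j / 2`.
  let C : ℝ := 2 + 2 ^ j₀
  have hC : 0 ≤ C := by positivity
  have hrun : ∀ j v : ℕ, v ≤ 2 ^ (j + 1) →
      |∑ m ∈ Finset.Ico (2 ^ j) v, f m| ≤ C * (4 / 3 : ℝ) ^ j := by
    intro j v hv
    have h43 : 1 ≤ (4 / 3 : ℝ) ^ j := one_le_pow₀ (by norm_num)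
    rcases lt_or_ge j j₀ with hj | hj
    · calc |∑ m ∈ Finset.Ico (2 ^ j) v, f m| ≤ ∑ m ∈ Finset.Ico (2 ^ j) v, |f m| :=
            Finset.abs_sum_le_sum_abs _ _
        _ ≤ ∑ m ∈ Finset.Ico (2 ^ j) v, (1 : ℝ) :=
            Finset.sum_le_sum fun _ _ => Real.abs_cos_le_one _
        _ = ((v - 2 ^ j : ℕ) : ℝ) := by simp
        _ ≤ ((2 ^ j₀ : ℕ) : ℝ) := by
            have h2 := Nat.pow_le_pow_right (n := 2) two_pos hj.le
            rw [pow_succ] at hv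
            exact_mod_cast (by omega : v - 2 ^ j ≤ 2 ^ j₀)
        _ ≤ C * 1 := by push_cast; simp [C]
        _ ≤ C * (4 / 3 : ℝ) ^ j := by gcongr
    · rcases le_or_gt v (2 ^ j) with hvj | hvj
      · rw [Finset.Ico_eq_empty_of_le hvj]
        simp only [Finset.sum_empty, abs_zero]
        positivity
      have hsin := (mul_le_mul_of_nonneg_left (hj₀ j hj) zero_le_two).trans
        (two_mul_norm_le_abs_sin (c j * x))
      have hpos : (0 : ℝ) < 2 * (3 / 4) ^ j := by positivity
      have hcos : ∑ m ∈ Finset.Ico (2 ^ j + 1) v, f m =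
          ∑ m ∈ Finset.Ico (2 ^ j + 1) v, Real.cos (2 * Real.pi * m * (c j * x)) := by
        refine Finset.sum_congr rfl fun m hm => ?_
        rw [Finset.mem_Ico] at hm
        obtain ⟨k, rfl⟩ : ∃ k, m = k + 1 := ⟨m - 1, by omega⟩
        simp only [f, Nat.add_sub_cancel]
        rw [hn j k (by omega) (by omega)]
        push_cast
        ring_nf
      rw [Finset.sum_eq_sum_Ico_succ_bot hvj, hcos]
      have h1 := abs_sum_cos_Ico_le (c j * x) (abs_pos.1 (hpos.trans_le hsin)) (2 ^ j + 1) v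
      have h2 := one_div_le_one_div_of_le hpos hsin
      have h3 : 1 / (2 * (3 / 4 : ℝ) ^ j) = (4 / 3 : ℝ) ^ j / 2 := by
        rw [show (4 / 3 : ℝ) = (3 / 4)⁻¹ by norm_num, inv_pow]
        field_simp
      have h4 : |f (2 ^ j)| ≤ 1 := Real.abs_cos_le_one _
      have h5 : 0 ≤ (2 : ℝ) ^ j₀ * (4 / 3) ^ j := by positivity
      refine (abs_add_le _ _).trans ?_
      simp only [C]
      linarith
  have hlog : Tendsto (fun N : ℕ => Nat.log 2 N) atTop atTop := by
    refine tendsto_atTop.2 fun b => ?_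
    filter_upwards [eventually_ge_atTop (2 ^ b)] with N hN
    exact Nat.le_log_of_pow_le one_lt_two hN
  have hgeom : Tendsto (fun J : ℕ => 4 * C * (4 / 3 / √2) ^ J) atTop (𝓝 0) := by
    have h2 : 4 / 3 < √2 := Real.lt_sqrt_of_sq_lt (by norm_num)
    have := (tendsto_pow_atTop_nhds_zero_of_lt_one (r := 4 / 3 / √2) (by positivity)
      ((div_lt_one (by positivity)).2 h2)).const_mul (4 * C)
    simpa using this
  refine squeeze_zero_norm' ?_ (hgeom.comp hlog)
  filter_upwards [eventually_gt_atTop 0] with N hN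
  have h1 := abs_sum_Ico_le_of_dyadic hC hrun (Nat.log 2 N) (N + 1)
    (Nat.lt_pow_succ_log_self one_lt_two N)
  have h2 : √2 ^ Nat.log 2 N ≤ √(N : ℝ) := by
    apply Real.le_sqrt_of_sq_le
    rw [← pow_mul, mul_comm, pow_mul, Real.sq_sqrt zero_le_two]
    exact_mod_cast Nat.pow_log_le_self 2 hN.ne'
  rw [Real.norm_eq_abs, abs_div, abs_of_nonneg (Real.sqrt_nonneg _), hsum]
  calc _ ≤ 4 * C * (4 / 3 : ℝ) ^ Nat.log 2 N / √2 ^ Nat.log 2 N := by gcongr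
    _ = _ := by simp only [Function.comp, div_pow]; ring

/-! ### Failure of the limit theorems for sums of order less than `√N` -/

theorem not_permutedCLT_of_tendsto {n : ℕ → ℕ} {σ : Equiv.Perm ℕ}
    (h : ∀ᵐ x ∂(volume.restrict (Set.Ioo (0 : ℝ) 1)),
      Tendsto (fun N : ℕ => permutedSum n σ N x / √N) atTop (𝓝 0)) : ¬ PermutedCLT n σ := by
  intro hclt
  have hcont : ∀ N, Continuous (permutedSum n σ N) := fun N => by
    unfold permutedSum; fun_prop
  have hm : TendstoInMeasure (volume.restrict (Set.Ioo (0 : ℝ) 1))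
      (fun (N : ℕ) x => permutedSum n σ N x / √N) atTop (fun _ => (0 : ℝ)) :=
    tendstoInMeasure_of_tendsto_ae
      (fun N => ((hcont N).div_const _).aestronglyMeasurable) h
  have hm' := tendstoInMeasure_iff_measureReal_norm.1 hm (1 / 2) (by norm_num)
  have hzero : Tendsto (fun N : ℕ => volume.real
      {x : ℝ | x ∈ Set.Ioo (0 : ℝ) 1 ∧ permutedSum n σ N x ≤ (-1) * √((N : ℝ) / 2)})
      atTop (𝓝 0) := by
    refine squeeze_zero' (Eventually.of_forall fun _ => measureReal_nonneg) ?_ hm'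
    filter_upwards [eventually_gt_atTop 0] with N hN
    have hN' : (0 : ℝ) < √(N : ℝ) := Real.sqrt_pos.2 (by exact_mod_cast hN)
    rw [measureReal_restrict_apply' measurableSet_Ioo]
    refine measureReal_mono ?_ ((measure_mono Set.inter_subset_right).trans_lt
      measure_Ioo_lt_top).ne
    rintro x ⟨hx, hxN⟩
    refine ⟨?_, hx⟩
    simp only [Set.mem_ofPred_eq, sub_zero, Real.norm_eq_abs]
    rw [abs_div, abs_of_pos hN', le_div_iff₀ hN']
    have h1 : 1 / 2 * √(N : ℝ) ≤ √((N : ℝ) / 2) := by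
      apply Real.le_sqrt_of_sq_le
      rw [mul_pow, Real.sq_sqrt N.cast_nonneg]
      linarith [(Nat.cast_nonneg N : (0 : ℝ) ≤ N)]
    linarith [neg_le_abs (permutedSum n σ N x)]
  -- At `t = -1` the limit would have to be 0, but the normal distribution function is positive
  -- there.
  have heq := tendsto_nhds_unique (hclt (-1)) hzero
  have hint : 0 < ∫ u in Set.Iic (-1 : ℝ), Real.exp (-u ^ 2 / 2) := by
    have : NeZero (volume.restrict (Set.Iic (-1 : ℝ))) := ⟨by
      rw [Ne, Measure.restrict_eq_zero]; simp⟩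
    refine integral_exp_pos (Integrable.integrableOn ?_)
    convert integrable_exp_neg_mul_sq (b := 1 / 2) (by norm_num) using 3
    ring
  have : 0 < (2 * Real.pi) ^ (-(1 / 2) : ℝ) := Real.rpow_pos_of_pos (by positivity) _
  exact (mul_pos this hint).ne' heq

theorem not_permutedLIL_of_tendsto {n : ℕ → ℕ} {σ : Equiv.Perm ℕ}
    (h : ∀ᵐ x ∂(volume.restrict (Set.Ioo (0 : ℝ) 1)),
      Tendsto (fun N : ℕ => permutedSum n σ N x / √N) atTop (𝓝 0)) : ¬ PermutedLIL n σ := by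
  intro hlil
  have hne : volume.restrict (Set.Ioo (0 : ℝ) 1) ≠ 0 := by
    rw [Ne, Measure.restrict_eq_zero]; simp
  have := ae_neBot.2 hne
  obtain ⟨x, hx, hlim⟩ := (h.and hlil).exists
  have hzero : Tendsto (fun N : ℕ =>
      permutedSum n σ N x / √((N : ℝ) * Real.log (Real.log (N : ℝ)))) atTop (𝓝 0) := by
    have hloglog : Tendsto (fun N : ℕ => Real.log (Real.log (N : ℝ))) atTop atTop :=
      Real.tendsto_log_atTop.comp (Real.tendsto_log_atTop.comp tendsto_natCast_atTop_atTop)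
    refine squeeze_zero_norm' ?_ (tendsto_zero_iff_norm_tendsto_zero.1 hx)
    filter_upwards [hloglog.eventually_ge_atTop 1, eventually_gt_atTop 0] with N h1 hN
    have hN' : (0 : ℝ) < N := by exact_mod_cast hN
    have h2 : √(N : ℝ) ≤ √((N : ℝ) * Real.log (Real.log (N : ℝ))) :=
      Real.sqrt_le_sqrt (le_mul_of_one_le_right hN'.le h1)
    rw [norm_div, norm_div, Real.norm_of_nonneg (Real.sqrt_nonneg _),
      Real.norm_of_nonneg (Real.sqrt_nonneg _)]
    exact div_le_div_of_nonneg_left (norm_nonneg _) (Real.sqrt_pos.2 hN') h2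
  have hE := (EReal.tendsto_coe.2 hzero).limsup_eq
  rw [hlim] at hE
  norm_num at hE

theorem theorem2 (ε : ℕ → ℝ) (hpos : ∀ k, 0 < ε k) (hlim : Tendsto ε atTop (𝓝 0)) :
    ∃ (n : ℕ → ℕ) (σ : Equiv.Perm ℕ),
      (∀ k, 0 < n k) ∧
      (∃ k₀ : ℕ, ∀ k ≥ k₀, (n (k + 1) : ℝ) / (n k : ℝ) ≥ 1 + ε k) ∧
      ¬ PermutedCLT n σ ∧
      ¬ PermutedLIL n σ := by
  obtain ⟨n, σ, c, hn, hgap, hc, hrun⟩ := exists_sequence_perm_runs hlim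
  have hae : ∀ᵐ x ∂(volume.restrict (Set.Ioo (0 : ℝ) 1)),
      Tendsto (fun N : ℕ => permutedSum n σ N x / √N) atTop (𝓝 0) := by
    filter_upwards [ae_eventually_le_norm_mul hc] with x hx
    exact tendsto_permutedSum_div_sqrt hrun hx
  exact ⟨n, σ, hn, hgap, not_permutedCLT_of_tendsto hae, not_permutedLIL_of_tendsto hae⟩
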